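/- Fix the following notions. An $n$-qubit circuit ($n\ge 1$) is a finite sequence of gates applied to the input $|0\rangle^{n}$ and followed by a standard basis measurement of the first qubit. A gate is one of the following single-qubit gates, applied to a target qubit and possibly controlled on other qubits being $|1\rangle$: Hadamard, the $\pi/8$-phase gate $\mathrm{diag}(1,e^{i\pi/4})$, NOT, or a real rotation $|0\rangle\mapsto\sqrt{1-\varepsilon}\,|0\rangle+\sqrt{\varepsilon}\,|1\rangle$, $|1\rangle\mapsto-\sqrt{\varepsilon}\,|0\rangle+\sqrt{1-\varepsilon}\,|1\rangle$ with $\varepsilon=(a+1)^{-b}$, $a,b\in\mathbb N$. A family of circuits $(\mathcal C_x)$ indexed by binary words $x$ is uniform if a Turing machine writes a description of $\mathcal C_x$ (with all natural numbers, including the number of qubits, in unary) in time polynomial in $|x|$. A promise problem is a pair of disjoint sets of binary words (yes-instances, no-instances); a decision problem is the case where they are complementary. It is in BQP if there is a uniform family of circuits $\mathcal C_x$ composed of Hadamard, $\pi/8$-phase and CNOT gates whose measurement gives $1$ with probability at least $2/3$ on every yes-instance $x$ and at most $1/3$ on every no-instance $x$. For a pure state $|\psi\rangle$ of $n$ qubits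 and a bipartition $(A,B)$ of the qubits, the entanglement entropy is $E^{A,B}(|\psi\rangle)=-\mathrm{Tr}\,\rho^A\log_2\rho^A$, where $\rho^A$ is the reduced density operator of $|\psi\rangle$ on $A$. A family $(\delta_n)_{n\ge 1}$ of positive reals is polynomially small if $1/\delta_n=O(p(n))$ for some polynomial $p$. **Observation 2.** Let $(\delta_n)$ be polynomially small. Then every problem in BQP can be solved efficiently by a pure-state circuit model in which, throughout the entire computation, the entanglement entropy of every $n$-qubit state is at most $O(\delta_n)$ for every bipartition. Precisely: there is a constant $C>0$, depending only on $(\delta_n)$, such that for every promise problem in BQP there are a uniform family of circuits $\mathcal C_x$, on $n_x$ qubits, of gates acting on at most three qubits each, and polynomials $r,s$ with coefficients in $\mathbb N$, such that: 1. for every $x$, the state $|\psi_t\rangle$ of the register after the first $t$ gates of $\mathcal C_x$ satisfies $E^{A,B}(|\psi_t\rangle)\le C\,\delta_{n_x}$ for every $t$ from $0$ to the number of gates and for every bipartition $(A,B)$ of the $n_x$ qubits; 2. running $\mathcal C_x$ independently $r(n_x)$ times, and answering "yes" if and only if at least $s(n_x)$ of the measurement outcomes are $1$, gives the answer "yes"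 with probability at least $2/3$ on every yes-instance $x$ and at most $1/3$ on every no-instance $x$. -/

import Mathlib

noncomputable section

namespace LowEntQC

/-! ### Pure states of a register of qubits, and their entanglement entropies -/

/-- Amplitudes, in the computational basis, of a vector in the space of `n` qubits. -/
abbrev StateVec (n : ℕ) : Type := (Fin n → Bool) → ℂ

/-- The input state `|0⟩ⁿ`. -/
def zeroState (n : ℕ) : StateVec n := fun x => if x = (fun _ => false) then 1 else 0

/-- The basis label that is `x` on the qubits in `A` and `z` on the remaining qubits. -/
def glue {n : ℕ} (A : Finset (Fin n)) (x : {i // i ∈ A} → Bool) (z : {i // i ∉ A} → Bool) :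
    Fin n → Bool :=
  fun i => if h : i ∈ A then x ⟨i, h⟩ else z ⟨i, h⟩

/-- The reduced density operator `ρ^A` of `|ψ⟩⟨ψ|`: all qubits outside `A` are traced out. -/
def reduced {n : ℕ} (ψ : StateVec n) (A : Finset (Fin n)) :
    Matrix ({i // i ∈ A} → Bool) ({i // i ∈ A} → Bool) ℂ :=
  Matrix.of fun x y => ∑ z : {i // i ∉ A} → Bool, ψ (glue A x z) * star (ψ (glue A y z))

theorem reduced_isHermitian {n : ℕ} (ψ : StateVec n) (A : Finset (Fin n)) :
    (reduced ψ A).IsHermitian := by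
  ext x y
  simp [reduced, Matrix.conjTranspose_apply, mul_comm]

/-- The von Neumann entropy `- Tr ρ log₂ ρ` of a Hermitian matrix, through its eigenvalues
(with `0 log 0 = 0`). -/
def vonNeumannEntropy {ι : Type*} [Fintype ι] [DecidableEq ι] {ρ : Matrix ι ι ℂ}
    (hρ : ρ.IsHermitian) : ℝ :=
  -∑ i, hρ.eigenvalues i * Real.logb 2 (hρ.eigenvalues i)

/-- The entanglement entropy of `ψ` across the bipartition `(A, Aᶜ)` of the qubits. -/
def entanglementEntropy {n : ℕ} (ψ : StateVec n) (A : Finset (Fin n)) : ℝ :=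
  vonNeumannEntropy (reduced_isHermitian ψ A)

/-! ### Gates and circuits -/

/-- Types of single-qubit gates: Hadamard, the `π/8`-phase gate, NOT, and the real rotations
by the angle whose sine is the square root of `ε = 1 / (a + 1) ^ b`. -/
inductive Kind : Type
  | had : Kind
  | phase : Kind
  | flip : Kind
  | rot (a b : ℕ) : Kind

/-- The squared sine of the angle of a rotation gate. -/
def rotEps (a b : ℕ) : ℝ := 1 / ((a : ℝ) + 1) ^ b

/-- The matrix of a single-qubit gate; `false` stands for `|0⟩` and `true` for `|1⟩`. -/
def Kind.matrix : Kind → Matrix Bool Bool ℂ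
  | .had => Matrix.of fun x y => if x && y then -((1 / √2 : ℝ) : ℂ) else ((1 / √2 : ℝ) : ℂ)
  | .phase => Matrix.of fun x y =>
      if x = y then (if x then Complex.exp (Real.pi / 4 * Complex.I) else 1) else 0
  | .flip => Matrix.of fun x y => if x = y then 0 else 1
  | .rot a b => Matrix.of fun x y =>
      if x = y then ((√(1 - rotEps a b) : ℝ) : ℂ)
      else if x then ((√(rotEps a b) : ℝ) : ℂ) else -((√(rotEps a b) : ℝ) : ℂ)

/-- A gate on a register of `n` qubits: the single-qubit gate `kind` acts on the qubit `target`,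
controlled on all the qubits in `controls` being in the state `|1⟩`. -/
structure Gate (n : ℕ) : Type where
  kind : Kind
  target : Fin n
  controls : List (Fin n)
  distinct : (target :: controls).Nodup

/-- The number of qubits on which a gate acts. -/
def Gate.arity {n : ℕ} (g : Gate n) : ℕ := g.controls.length + 1

/-- The gates of the universal set consisting of the Hadamard gate, the `π/8`-phase gate and
CNOT. -/
def Gate.IsBasic {n : ℕ} (g : Gate n) : Prop :=
  (g.kind = .had ∧ g.arity = 1) ∨ (g.kind = .phase ∧ g.arity = 1) ∨
    (g.kind = .flip ∧ g.arity = 2)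

/-- The action of a gate on a state. -/
def Gate.apply {n : ℕ} (g : Gate n) (ψ : StateVec n) : StateVec n := fun x =>
  if ∀ c ∈ g.controls, x c = true then
    ∑ b : Bool, g.kind.matrix (x g.target) b * ψ (Function.update x g.target b)
  else ψ x

/-- A circuit: a nonempty register of `n` qubits and a finite sequence of gates. -/
structure Circuit : Type where
  n : ℕ
  pos : 0 < n
  gates : List (Gate n)

/-- The state of the register after the first `t` gates, on the input `|0⟩ⁿ`. -/
def Circuit.stateAfter (C : Circuit) (t : ℕ) : StateVec C.n :=
  (C.gates.take t).foldl (fun ψ g => g.apply ψ) (zeroState C.n)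

/-- The probability that the standard basis measurement of the first qubit, after all gates,
gives the outcome `1`. -/
def Circuit.probOne (C : Circuit) : ℝ :=
  ∑ x : Fin C.n → Bool,
    if x ⟨0, C.pos⟩ = true then ‖C.stateAfter C.gates.length x‖ ^ 2 else 0

/-- The probability that, in `T` independent runs of `C`, at least `θ` of the `T` measurement
outcomes are `1`. -/
def Circuit.probAtLeast (C : Circuit) (T θ : ℕ) : ℝ :=
  ∑ k ∈ Finset.Icc θ T, (T.choose k : ℝ) * C.probOne ^ k * (1 - C.probOne) ^ (T - k)

/-! ### Descriptions of circuits as words, and uniformity -/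

/-- The alphabet in which circuits are written down. -/
inductive Sym : Type
  | one | had | phase | flip | rot | exponent | target | control
  deriving DecidableEq

/-- Natural numbers are written in unary. -/
def unary (k : ℕ) : List Sym := List.replicate k Sym.one

def Kind.encode : Kind → List Sym
  | .had => [.had]
  | .phase => [.phase]
  | .flip => [.flip]
  | .rot a b => Sym.rot :: unary a ++ Sym.exponent :: unary b

def Gate.encode {n : ℕ} (g : Gate n) : List Sym :=
  g.kind.encode ++ Sym.target :: unary g.target ++
    g.controls.flatMap (fun c => Sym.control :: unary c)

/-- The description of a circuit: the number of qubits, then the gates in order. Numbers being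
in unary, a circuit with a description of length `ℓ` has at most `ℓ` qubits and gates. -/
def Circuit.encode (C : Circuit) : List Sym :=
  unary C.n ++ C.gates.flatMap Gate.encode

/-- The circuit family `F` is polynomial-time uniform: a Turing machine writes the description of
`F x` on the input word `x` in time polynomial in the length of `x`. -/
def PolyTimeUniform (F : List Bool → Circuit) : Prop :=
  Nonempty (Turing.TM2ComputableInPolyTime (id : List Bool → List Bool) Circuit.encode F)

/-! ### Decision problems and their efficient solution -/

/-- A promise problem on binary words (a decision problem when `no = yesᶜ`). -/
structure PromiseProblem : Type where
  yes : Set (List Bool)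
  no : Set (List Bool)
  disjoint : Disjoint yes no

/-- The class BQP, with circuits over the Hadamard, `π/8`-phase and CNOT gates. -/
def InBQP (P : PromiseProblem) : Prop :=
  ∃ F : List Bool → Circuit, PolyTimeUniform F ∧
    (∀ x, ∀ g ∈ (F x).gates, g.IsBasic) ∧
    (∀ x ∈ P.yes, 2 / 3 ≤ (F x).probOne) ∧
    (∀ x ∈ P.no, (F x).probOne ≤ 1 / 3)

/-- In every step of the computation, the entanglement entropy across every bipartition of the
register is at most `β`. -/
def Circuit.EntropyAtMost (C : Circuit) (β : ℝ) : Prop :=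
  ∀ t ≤ C.gates.length, ∀ A : Finset (Fin C.n), entanglementEntropy (C.stateAfter t) A ≤ β

/-- `P` is efficiently solvable, with error probability at most `1/3`, by a quantum computer that
runs circuits of gates on at most three qubits and in which the entanglement entropies of every
state of the `n`-qubit register are at most `β n`. On the input `x`, a circuit `F x` is computed
in polynomial time and is run a number of times that is polynomial in its number of qubits; the
answer is 'yes' when the number of outcomes `1` reaches a threshold, also given by a polynomial. -/
def SolvableWithEntropyAtMost (β : ℕ → ℝ) (P : PromiseProblem) : Prop :=
  ∃ F : List Bool → Circuit, PolyTimeUniform F ∧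
    (∀ x, ∀ g ∈ (F x).gates, g.arity ≤ 3) ∧
    (∀ x, (F x).EntropyAtMost (β (F x).n)) ∧
    ∃ runs threshold : Polynomial ℕ,
      (∀ x ∈ P.yes,
        2 / 3 ≤ (F x).probAtLeast (runs.eval (F x).n) (threshold.eval (F x).n)) ∧
      (∀ x ∈ P.no,
        (F x).probAtLeast (runs.eval (F x).n) (threshold.eval (F x).n) ≤ 1 / 3)

/-- A family of parameters `δ₁, δ₂, …` is polynomially small if all are positive and
`1 / δₙ = O(p(n))` for some polynomial `p`. -/
def PolynomiallySmall (δ : ℕ → ℝ) : Prop :=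
  (∀ n, 1 ≤ n → 0 < δ n) ∧
    ∃ p : Polynomial ℝ,
      Asymptotics.IsBigO Filter.atTop (fun n : ℕ => 1 / δ n) (fun n : ℕ => p.eval (n : ℝ))

end LowEntQC

end

noncomputable section

namespace LowEntQC

open Turing

/-! A computation can be made almost unentangled by letting it happen only with small amplitude.
Given a BQP circuit on n qubits, put a control qubit in front, rotate it to √(1-ε)|0⟩ + √ε|1⟩ with ε
= (n+1)^(-b), and control every gate by it. The register is then √(1-ε)|0⟩|0…0⟩ + √ε|1⟩|φ⟩, where φ
runs through the states of the original circuit.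

Entropy: only the rotation is uncontrolled, so the amplitude of the all-zero label never drops below
√(1-ε) in modulus (`le_norm_sq_weaken_zero`). Every reduced density matrix therefore has an
eigenvalue at least 1-ε, and on N = n+1 qubits its entropy is at most 2ε(2 + N + ln(1/ε))
(`entanglementEntropy_le`). Since ε = N^(-b), a large b brings this below a multiple of δ_N
(`PolynomiallySmall.exists_bound`).

Correctness: two final CNOTs make the first qubit yield 1 with probability exactly εp, where p is
the original probability (`probOne_weaken`). In 144/ε runs the expected number of ones is 144p, at
least 96 or at most 48, and Chebyshev's inequality separates the two cases at the threshold 72.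

Uniformity: the new description arises from the old one by duplicating the leading unary number,
inserting fixed words and rewriting letter by letter (`encode_weaken`). A stack machine extended by
two stacks does this after the original program halts (`PolyTimeUniform.postprocess`). -/

/-! ### Counting steps of stack machines -/

/-- `b` is reached from `a` in exactly `n` steps of the partial map `f`. -/
def ReachesIn {σ : Type*} (f : σ → Option σ) (n : ℕ) (a b : σ) : Prop :=
  (flip bind f)^[n] (some a) = some b

theorem ReachesIn.refl {σ : Type*} (f : σ → Option σ) (a : σ) : ReachesIn f 0 a a := rfl

theorem ReachesIn.trans {σ : Type*} {f : σ → Option σ} {m n : ℕ} {a b c : σ}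
    (h₁ : ReachesIn f m a b) (h₂ : ReachesIn f n b c) : ReachesIn f (m + n) a c := by
  unfold ReachesIn at *
  rw [add_comm, Function.iterate_add_apply, h₁, h₂]

theorem ReachesIn.congr {σ : Type*} {f : σ → Option σ} {n : ℕ} {a b a' b' : σ} (ha : a = a')
    (hb : b = b') (h : ReachesIn f n a b) : ReachesIn f n a' b' :=
  ha ▸ hb ▸ h

theorem ReachesIn.single {σ : Type*} {f : σ → Option σ} {a b : σ} (h : f a = some b) :
    ReachesIn f 1 a b := h

theorem ReachesIn.head {σ : Type*} {f : σ → Option σ} {n : ℕ} {a b c : σ}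
    (h₁ : f a = some b) (h₂ : ReachesIn f n b c) : ReachesIn f (n + 1) a c := by
  rw [add_comm]
  exact (ReachesIn.single h₁).trans h₂

theorem iterate_bind_none {σ : Type*} (f : σ → Option σ) (n : ℕ) :
    (flip bind f)^[n] none = none :=
  Function.iterate_fixed rfl n

theorem ReachesIn.exists_of_succ {σ : Type*} {f : σ → Option σ} {n : ℕ} {a c : σ}
    (h : ReachesIn f (n + 1) a c) : ∃ b, f a = some b ∧ ReachesIn f n b c := by
  unfold ReachesIn at h
  rw [Function.iterate_succ_apply] at h
  change (flip bind f)^[n] (f a) = some c at h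
  cases hb : f a with
  | none => rw [hb, iterate_bind_none] at h; cases h
  | some b => exact ⟨b, rfl, by rw [hb] at h; exact h⟩

/-- A map that commutes with the steps from all nonhalting configurations commutes with runs. -/
theorem ReachesIn.map {σ τ : Type*} {f : σ → Option σ} {g : τ → Option τ} (φ : σ → τ)
    (hφ : ∀ a b, f a = some b → g (φ a) = some (φ b)) {n : ℕ} {a b : σ} (h : ReachesIn f n a b) :
    ReachesIn g n (φ a) (φ b) := by
  induction n generalizing a with
  | zero => cases h; exact ReachesIn.refl _ _
  | succ n ih =>
    obtain ⟨c, hc, h⟩ := h.exists_of_succ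
    exact (ih h).head (hφ _ _ hc)

/-- A quantity that grows by at most `c` in each step grows by at most `n * c` in `n` steps. -/
theorem ReachesIn.measure_le {σ : Type*} {f : σ → Option σ} (μ : σ → ℕ) (c : ℕ)
    (hμ : ∀ a b, f a = some b → μ b ≤ μ a + c) {n : ℕ} {a b : σ} (h : ReachesIn f n a b) :
    μ b ≤ μ a + n * c := by
  induction n generalizing a with
  | zero => cases h; simp
  | succ n ih =>
    obtain ⟨d, hd, h⟩ := h.exists_of_succ
    have := ih h
    have := hμ _ _ hd
    linarith

theorem initList_stk (M : FinTM2) (s : List (M.Γ M.k₀)) :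
    (initList M s).stk = Function.update (fun _ => []) M.k₀ s := by
  funext k
  by_cases h : k = M.k₀
  · subst h; simp [initList]
  · simp [initList, h]

theorem haltList_stk (M : FinTM2) (s : List (M.Γ M.k₁)) :
    (haltList M s).stk = Function.update (fun _ => []) M.k₁ s := by
  funext k
  by_cases h : k = M.k₁
  · subst h; simp [haltList]
  · simp [haltList, h]

theorem initList_eq (M : FinTM2) (s : List (M.Γ M.k₀)) :
    initList M s = ⟨some M.main, M.initialState, Function.update (fun _ => []) M.k₀ s⟩ := by
  rw [← initList_stk]; rfl

theorem haltList_eq (M : FinTM2) (s : List (M.Γ M.k₁)) :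
    haltList M s = ⟨none, M.initialState, Function.update (fun _ => []) M.k₁ s⟩ := by
  rw [← haltList_stk]; rfl

/-- The number of symbols that a statement can push. -/
def pushCount {K : Type*} {Γ : K → Type*} {Λ σ : Type*} : TM2.Stmt Γ Λ σ → ℕ
  | .push _ _ q => pushCount q + 1
  | .peek _ _ q => pushCount q
  | .pop _ _ q => pushCount q
  | .load _ q => pushCount q
  | .branch _ q₁ q₂ => pushCount q₁ + pushCount q₂
  | .goto _ => 0
  | .halt => 0

/-- Only a push lengthens a stack, and by one symbol. A single arm of a branch is executed, so
counting both can only overestimate. This is what bounds the written description, since uniformity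
only bounds running time. -/
theorem length_stepAux_le {K : Type*} [DecidableEq K] {Γ : K → Type*} {Λ σ : Type*}
    (q : TM2.Stmt Γ Λ σ) (v : σ) (S : ∀ k, List (Γ k)) (k : K) :
    ((TM2.stepAux q v S).stk k).length ≤ (S k).length + pushCount q := by
  induction q generalizing v S with
  | push k' f q ih =>
    refine (ih _ _).trans ?_
    by_cases h : k = k'
    · subst h; simp [pushCount]; try omega
    · simp only [Function.update_of_ne h, pushCount]; omega
  | peek k' f q ih => exact ih _ _
  | pop k' f q ih =>
    refine (ih _ _).trans ?_
    by_cases h : k = k'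
    · subst h; simp [pushCount]
    · simp [pushCount, h]
  | load f q ih => exact ih _ _
  | branch f q₁ q₂ ih₁ ih₂ =>
    rw [TM2.stepAux, pushCount]
    cases f v
    · exact (ih₂ _ _).trans (by omega)
    · exact (ih₁ _ _).trans (by omega)
  | goto f => simp [pushCount]
  | halt => simp [pushCount]

/-- A bound for the number of symbols that a machine pushes in one step. -/
def maxPush (M : FinTM2) : ℕ :=
  letI := M.ΛFin
  ∑ l : M.Λ, pushCount (M.m l)

theorem length_step_le (M : FinTM2) (k : M.K) (a b : M.Cfg) (h : M.step a = some b) :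
    (b.stk k).length ≤ (a.stk k).length + maxPush M := by
  let _ := M.ΛFin
  obtain ⟨l, v, S⟩ := a
  cases l with
  | none => simp at h
  | some l =>
    obtain rfl := Option.some.inj h
    refine (length_stepAux_le _ _ _ _).trans (Nat.add_le_add_left ?_ _)
    exact Finset.single_le_sum (f := fun l => pushCount (M.m l)) (fun _ _ => Nat.zero_le _)
      (Finset.mem_univ l)

/-- The length of the output is at most the length of the input plus a multiple of the time. -/
theorem output_length_le (M : FinTM2) {s : List (M.Γ M.k₀)} {s' : List (M.Γ M.k₁)} {t : ℕ}
    (h : ReachesIn M.step t (initList M s) (haltList M s')) :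
    s'.length ≤ s.length + t * maxPush M := by
  have := h.measure_le (fun c => (c.stk M.k₁).length) (maxPush M) (length_step_le M M.k₁)
  refine le_trans ?_ (this.trans (Nat.add_le_add_right ?_ _))
  · rw [haltList_stk]; simp
  · rw [initList_stk]
    by_cases h : M.k₁ = M.k₀
    · rw [h]; simp
    · simp [h]

/-! ### Postprocessing the output of a machine that writes a circuit -/

instance : Fintype Sym :=
  ⟨{.one, .had, .phase, .flip, .rot, .exponent, .target, .control}, fun x => by cases x <;> simp⟩

/-- The labels of the postprocessing program. -/
inductive Phase : Type
  | count | refill | scan | emit (a : Sym) | rev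
  deriving DecidableEq

instance : Fintype Phase :=
  Fintype.ofSurjective
    (fun x : Option (Option (Option (Option Sym))) =>
      match x with
      | none => Phase.count
      | some none => Phase.refill
      | some (some none) => Phase.scan
      | some (some (some none)) => Phase.rev
      | some (some (some (some a))) => Phase.emit a)
    (fun y => by
      cases y with
      | count => exact ⟨none, rfl⟩
      | refill => exact ⟨some none, rfl⟩
      | scan => exact ⟨some (some none), rfl⟩
      | rev => exact ⟨some (some (some none)), rfl⟩
      | emit a => exact ⟨some (some (some (some a))), rfl⟩)

section Post

variable (M : FinTM2)

/-- The stack alphabets of the machine extended by two stacks of symbols. -/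
abbrev PostΓ : M.K ⊕ Bool → Type := Sum.elim M.Γ (fun _ => Sym)

abbrev PostΛ : Type := M.Λ ⊕ Phase

abbrev Postσ : Type := M.σ × Option Sym

abbrev PostStmt : Type := TM2.Stmt (PostΓ M) (PostΛ M) (Postσ M)

variable {M}

/-- The contents of all stacks. -/
def joinStk (S : ∀ k, List (M.Γ k)) (R T : List Sym) : ∀ k, List (PostΓ M k)
  | .inl k => S k
  | .inr false => R
  | .inr true => T

theorem update_joinStk_inl (S : ∀ k, List (M.Γ k)) (R T : List Sym) (k : M.K) (w : List (M.Γ k)) :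
    Function.update (joinStk S R T) (Sum.inl k) w = joinStk (Function.update S k w) R T := by
  funext j
  rcases j with j | _ | _
  · by_cases h : j = k
    · subst h
      have h₁ : Function.update S j w j = w := Function.update_self _ _ _
      exact (Function.update_self _ _ _).trans h₁.symm
    · exact (Function.update_of_ne (fun e => h (Sum.inl.inj e)) _ _).trans
        (Function.update_of_ne h _ _).symm
  · rfl
  · rfl

theorem update_joinStk_false (S : ∀ k, List (M.Γ k)) (R T w : List Sym) :
    Function.update (joinStk S R T) (Sum.inr false) w = joinStk S w T := by
  funext j
  rcases j with j | _ | _ <;> rfl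

theorem update_joinStk_true (S : ∀ k, List (M.Γ k)) (R T w : List Sym) :
    Function.update (joinStk S R T) (Sum.inr true) w = joinStk S R w := by
  funext j
  rcases j with j | _ | _ <;> rfl

/-- A statement of the machine as a statement of the extended machine, which goes on to the
postprocessing instead of halting. -/
def liftStmt : TM2.Stmt M.Γ M.Λ M.σ → PostStmt M
  | .push k f q => .push (Sum.inl k) (fun s => f s.1) (liftStmt q)
  | .peek k f q => .peek (Sum.inl k) (fun s a => (f s.1 a, s.2)) (liftStmt q)
  | .pop k f q => .pop (Sum.inl k) (fun s a => (f s.1 a, s.2)) (liftStmt q)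
  | .load f q => .load (fun s => (f s.1, s.2)) (liftStmt q)
  | .branch f q₁ q₂ => .branch (fun s => f s.1) (liftStmt q₁) (liftStmt q₂)
  | .goto f => .goto (fun s => Sum.inl (f s.1))
  | .halt => .goto (fun _ => Sum.inr .count)

/-- A configuration of the machine as a configuration of the extended machine. -/
def liftCfg (c : TM2.Cfg M.Γ M.Λ M.σ) : TM2.Cfg (PostΓ M) (PostΛ M) (Postσ M) :=
  ⟨some (c.l.elim (Sum.inr .count) Sum.inl), (c.var, none), joinStk c.stk [] []⟩

/-- Lifted statements never touch the added register or stacks, so these stay `none` and empty; a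
halt turns into the entry to `count`, exactly as `liftCfg` translates halted configurations. -/
theorem stepAux_liftStmt (q : TM2.Stmt M.Γ M.Λ M.σ) (v : M.σ) (S : ∀ k, List (M.Γ k)) :
    TM2.stepAux (liftStmt q) (v, none) (joinStk S [] []) = liftCfg (TM2.stepAux q v S) := by
  induction q generalizing v S with
  | push k f q ih =>
    exact (congrArg (TM2.stepAux (liftStmt q) (v, none)) (update_joinStk_inl S [] [] k _)).trans
      (ih _ _)
  | peek k f q ih => exact ih _ _
  | pop k f q ih =>
    exact (congrArg (TM2.stepAux (liftStmt q) (f v (S k).head?, none))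
      (update_joinStk_inl S [] [] k _)).trans (ih _ _)
  | load f q ih => exact ih _ _
  | branch f q₁ q₂ ih₁ ih₂ =>
    change cond (f v) _ _ = liftCfg (cond (f v) _ _)
    cases f v
    · exact ih₂ _ _
    · exact ih₁ _ _
  | goto f => rfl
  | halt => rfl

/-- Push all symbols of a list onto the first additional stack. -/
def pushList (l : List Sym) (q : PostStmt M) : PostStmt M :=
  l.foldr (fun a q => .push (Sum.inr false) (fun _ => a) q) q

theorem stepAux_pushList (l : List Sym) (q : PostStmt M) (v : Postσ M) (S : ∀ k, List (M.Γ k))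
    (R T : List Sym) :
    TM2.stepAux (pushList l q) v (joinStk S R T) =
      TM2.stepAux q v (joinStk S (l.reverse ++ R) T) := by
  induction l generalizing R with
  | nil => rfl
  | cons a l ih =>
    rw [List.reverse_cons, List.append_assoc]
    exact (congrArg (TM2.stepAux (pushList l q) v) (update_joinStk_false S R T _)).trans (ih _)

variable (e : M.Γ M.k₁ ≃ Sym) (mid post : List Sym) (h : Sym → List Sym)

/-- The postprocessing program: duplicate the leading unary number, insert words, rewrite all
further symbols, and bring the result to the output stack. -/
def postProgram : Phase → PostStmt M
  -- Peeking keeps the first symbol after the number on the stack for `scan`. Each `one` is saved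
  -- twice: in the result, and on the second stack for reuse as the rotation parameter.
  | .count => .peek (Sum.inl M.k₁) (fun s a => (s.1, a.map e))
      (.branch (fun s => s.2 = some Sym.one)
        (.pop (Sum.inl M.k₁) (fun s _ => s) <| .push (Sum.inr true) (fun _ => Sym.one) <|
          pushList [.one] <| .goto fun _ => Sum.inr .count)
        -- The extra `one` counts the new control qubit; `rot` opens the first gate.
        (pushList [.one, .rot] <| .goto fun _ => Sum.inr .refill))
  | .refill => .pop (Sum.inr true) (fun s a => (s.1, a))
      (.branch (fun s => s.2.isSome)
        (pushList [.one] <| .goto fun _ => Sum.inr .refill)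
        (pushList mid <| .goto fun _ => Sum.inr .scan))
  | .scan => .pop (Sum.inl M.k₁) (fun s a => (s.1, a.map e))
      (.branch (fun s => s.2.isSome)
        (.goto fun s => Sum.inr (.emit (s.2.getD .one)))
        (pushList post <| .goto fun _ => Sum.inr .rev))
  | .emit a => pushList (h a) <| .goto fun _ => Sum.inr .scan
  | .rev => .pop (Sum.inr false) (fun s a => (s.1, a))
      (.branch (fun s => s.2.isSome)
        (.push (Sum.inl M.k₁) (fun s => e.symm (s.2.getD .one)) <| .goto fun _ => Sum.inr .rev)
        .halt)

/-- The extended machine. -/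
def postMachine : FinTM2 :=
  letI := M.ΛFin
  letI := M.σFin
  letI := M.kFin
  { K := M.K ⊕ Bool
    k₀ := Sum.inl M.k₀
    k₁ := Sum.inl M.k₁
    Γ := PostΓ M
    Λ := PostΛ M
    main := Sum.inl M.main
    σ := Postσ M
    initialState := (M.initialState, none)
    Γk₀Fin := M.Γk₀Fin
    m := Sum.elim (fun l => liftStmt (M.m l)) (postProgram e mid post h) }

/-- A configuration of the extended machine in which the stacks of the original machine other than
the output stack are empty. -/
def postCfg (l : Phase) (o : Option Sym) (w R T : List Sym) :
    TM2.Cfg (PostΓ M) (PostΛ M) (Postσ M) :=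
  ⟨some (Sum.inr l), (M.initialState, o),
    joinStk (Function.update (fun _ => []) M.k₁ (w.map e.symm)) R T⟩

abbrev postStep : TM2.Cfg (PostΓ M) (PostΛ M) (Postσ M) →
    Option (TM2.Cfg (PostΓ M) (PostΛ M) (Postσ M)) :=
  TM2.step (Sum.elim (fun l => liftStmt (M.m l)) (postProgram e mid post h))

theorem count_step (o : Option Sym) (w R T : List Sym) :
    postStep e mid post h (postCfg e .count o (.one :: w) R T) =
      some (postCfg e .count (some .one) w (.one :: R) (.one :: T)) := by
  simp [postStep, postCfg, TM2.step, postProgram, TM2.stepAux, joinStk, pushList,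
    update_joinStk_inl, update_joinStk_false, update_joinStk_true]

theorem count_last (o : Option Sym) (w R T : List Sym) (hw : w.head? ≠ some .one) :
    postStep e mid post h (postCfg e .count o w R T) =
      some (postCfg e .refill w.head? w (.rot :: .one :: R) T) := by
  cases w <;> simp_all [postStep, postCfg, TM2.step, postProgram, TM2.stepAux, joinStk, pushList,
    update_joinStk_inl, update_joinStk_false, update_joinStk_true]

theorem refill_step (o : Option Sym) (a : Sym) (w R T : List Sym) :
    postStep e mid post h (postCfg e .refill o w R (a :: T)) =
      some (postCfg e .refill (some a) w (.one :: R) T) := by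
  simp [postStep, postCfg, TM2.step, postProgram, TM2.stepAux, joinStk, pushList,
    update_joinStk_false, update_joinStk_true]

theorem refill_last (o : Option Sym) (w R : List Sym) :
    postStep e mid post h (postCfg e .refill o w R []) =
      some (postCfg e .scan none w (mid.reverse ++ R) []) := by
  simp [postStep, postCfg, TM2.step, postProgram, TM2.stepAux, joinStk, stepAux_pushList,
    update_joinStk_true]

theorem scan_step (o : Option Sym) (a : Sym) (w R T : List Sym) :
    postStep e mid post h (postCfg e .scan o (a :: w) R T) =
      some (postCfg e (.emit a) (some a) w R T) := by
  simp [postStep, postCfg, TM2.step, postProgram, TM2.stepAux, joinStk,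
    update_joinStk_inl]

theorem scan_last (o : Option Sym) (R T : List Sym) :
    postStep e mid post h (postCfg e .scan o [] R T) =
      some (postCfg e .rev none [] (post.reverse ++ R) T) := by
  simp [postStep, postCfg, TM2.step, postProgram, TM2.stepAux, joinStk, stepAux_pushList,
    update_joinStk_inl]

theorem emit_step (o : Option Sym) (a : Sym) (w R T : List Sym) :
    postStep e mid post h (postCfg e (.emit a) o w R T) =
      some (postCfg e .scan o w ((h a).reverse ++ R) T) := by
  simp [postStep, postCfg, TM2.step, postProgram, TM2.stepAux, stepAux_pushList]

theorem rev_step (o : Option Sym) (a : Sym) (w R T : List Sym) :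
    postStep e mid post h (postCfg e .rev o w (a :: R) T) =
      some (postCfg e .rev (some a) (a :: w) R T) := by
  simp [postStep, postCfg, TM2.step, postProgram, TM2.stepAux, joinStk,
    update_joinStk_inl, update_joinStk_false]

/-- The failed pop resets the register to `none`. With the additional stacks empty, this is the form
required of a halting configuration. -/
theorem rev_last (o : Option Sym) (w T : List Sym) :
    postStep e mid post h (postCfg e .rev o w [] T) =
      some ⟨none, (M.initialState, none),
        joinStk (Function.update (fun _ => []) M.k₁ (w.map e.symm)) [] T⟩ := by
  simp [postStep, postCfg, TM2.step, postProgram, TM2.stepAux, joinStk,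
    update_joinStk_false]

theorem count_run (m : ℕ) (o : Option Sym) (w R T : List Sym) (hw : w.head? ≠ some .one) :
    ReachesIn (postStep e mid post h) (m + 1) (postCfg e .count o (unary m ++ w) R T)
      (postCfg e .refill w.head? w (.rot :: .one :: (unary m ++ R)) (unary m ++ T)) := by
  induction m generalizing o R T with
  | zero => exact ReachesIn.single (count_last e mid post h o w R T hw)
  | succ m ih =>
    -- A word of equal symbols absorbs one more at either end, so the stack reversal is invisible
    -- here.
    have h1 : ∀ R : List Sym, unary (m + 1) ++ R = unary m ++ (.one :: R) := by
      intro R; simp [unary, List.replicate_succ', List.append_assoc]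
    rw [h1 R, h1 T]
    exact (ih _ _ _).head (count_step e mid post h o (unary m ++ w) R T)

theorem refill_run (m : ℕ) (o : Option Sym) (w R : List Sym) :
    ReachesIn (postStep e mid post h) (m + 1) (postCfg e .refill o w R (unary m))
      (postCfg e .scan none w (mid.reverse ++ (unary m ++ R)) []) := by
  induction m generalizing o R with
  | zero => exact ReachesIn.single (refill_last e mid post h o w R)
  | succ m ih =>
    have h1 : ∀ R : List Sym, unary (m + 1) ++ R = unary m ++ (.one :: R) := by
      intro R; simp [unary, List.replicate_succ', List.append_assoc]
    rw [h1 R]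
    exact (ih _ _).head (refill_step e mid post h o .one w R (unary m))

theorem scan_run (o : Option Sym) (w R T : List Sym) :
    ReachesIn (postStep e mid post h) (2 * w.length + 1) (postCfg e .scan o w R T)
      (postCfg e .rev none [] (post.reverse ++ ((w.flatMap h).reverse ++ R)) T) := by
  induction w generalizing o R with
  | nil => exact ReachesIn.single (scan_last e mid post h o R T)
  | cons a w ih =>
    have := ((ih (some a) ((h a).reverse ++ R)).head (emit_step e mid post h _ a w R T)).head
      (scan_step e mid post h o a w R T)
    simpa [List.flatMap_cons, mul_add, List.append_assoc] using this

theorem rev_run (o : Option Sym) (w R T : List Sym) :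
    ReachesIn (postStep e mid post h) (R.length + 1) (postCfg e .rev o w R T)
      ⟨none, (M.initialState, none),
        joinStk (Function.update (fun _ => []) M.k₁ ((R.reverse ++ w).map e.symm)) [] T⟩ := by
  induction R generalizing o w with
  | nil => exact ReachesIn.single (rev_last e mid post h o w T)
  | cons a R ih =>
    have := (ih (some a) (a :: w)).head (rev_step e mid post h o a w R T)
    simpa [List.append_assoc] using this

/-- The result of the postprocessing of the word that consists of a unary number and a word. -/
def postWord (m : ℕ) (w : List Sym) : List Sym :=
  unary m ++ [.one, .rot] ++ unary m ++ mid ++ w.flatMap h ++ post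

theorem post_run (m : ℕ) (w : List Sym) (hw : w.head? ≠ some .one) :
    ReachesIn (postStep e mid post h)
      (m + 1 + (m + 1) + (2 * w.length + 1) + ((postWord mid post h m w).length + 1))
      (postCfg e .count none (unary m ++ w) [] [])
      ⟨none, (M.initialState, none), joinStk (Function.update (fun _ => []) M.k₁
        ((postWord mid post h m w).map e.symm)) [] []⟩ := by
  have h1 := count_run e mid post h m none w [] [] hw
  simp only [List.append_nil] at h1
  have h2 := refill_run e mid post h m w.head? w (Sym.rot :: Sym.one :: unary m)
  have h3 := scan_run e mid post h none w (mid.reverse ++ (unary m ++ (Sym.rot :: Sym.one ::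
    unary m))) []
  have h4 := rev_run e mid post h none [] (post.reverse ++ ((w.flatMap h).reverse ++
    (mid.reverse ++ (unary m ++ (Sym.rot :: Sym.one :: unary m))))) []
  have h5 : (postWord mid post h m w) = (post.reverse ++ ((w.flatMap h).reverse ++
    (mid.reverse ++ (unary m ++ (Sym.rot :: Sym.one :: unary m))))).reverse ++ [] := by
    simp [postWord, unary, List.append_assoc]
  have h6 := ((h1.trans h2).trans h3).trans h4
  rw [← h5] at h6
  convert h6 using 2
  rw [h5]
  simp
  omega

/-- The extended machine writes the postprocessed word. -/
theorem postMachine_run {t m : ℕ} {w : List Sym} {s : List (M.Γ M.k₀)}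
    (hw : w.head? ≠ some .one)
    (hrun : ReachesIn M.step t (initList M s) (haltList M ((unary m ++ w).map e.symm))) :
    ReachesIn (postMachine e mid post h).step
      (t + (m + 1 + (m + 1) + (2 * w.length + 1) + ((postWord mid post h m w).length + 1)))
      (initList (postMachine e mid post h) s)
      (haltList (postMachine e mid post h) ((postWord mid post h m w).map e.symm)) := by
  have hj : ∀ (k : M.K) (s : List (M.Γ k)),
      Function.update (fun _ => [] : ∀ k, List (PostΓ M k)) (Sum.inl k) s =
      joinStk (M := M) (Function.update (fun _ => []) k s) [] [] := by
    intro k s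
    rw [← update_joinStk_inl]
    congr 1
    funext j
    rcases j with j | _ | _ <;> rfl
  have hi : initList (postMachine e mid post h) s = liftCfg (initList M s) := by
    refine (initList_eq (postMachine e mid post h) s).trans (Eq.trans ?_
      (congrArg liftCfg (initList_eq M s)).symm)
    exact congrArg (fun S => (⟨some (Sum.inl M.main), (M.initialState, none), S⟩ :
      TM2.Cfg (PostΓ M) (PostΛ M) (Postσ M))) (hj M.k₀ s)
  have ho : ∀ w : List (M.Γ M.k₁), haltList (postMachine e mid post h) w =
      (⟨none, (M.initialState, none), joinStk (Function.update (fun _ => []) M.k₁ w) [] []⟩ :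
      TM2.Cfg (PostΓ M) (PostΛ M) (Postσ M)) := by
    intro w
    refine (haltList_eq (postMachine e mid post h) w).trans ?_
    exact congrArg (fun S => (⟨none, (M.initialState, none), S⟩ :
      TM2.Cfg (PostΓ M) (PostΛ M) (Postσ M))) (hj M.k₁ w)
  refine ReachesIn.congr hi.symm (ho _).symm ?_
  refine ReachesIn.trans (b := postCfg e .count none (unary m ++ w) [] []) ?_
    (post_run e mid post h m w hw)
  have h1 : postCfg e .count none (unary m ++ w) [] [] =
      liftCfg (haltList M ((unary m ++ w).map e.symm)) := by
    exact (congrArg liftCfg (haltList_eq M _)).symm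
  rw [h1]
  -- Only configurations that still have a step need to be simulated; the halted one is already the
  -- start of the postprocessing.
  refine hrun.map liftCfg ?_
  rintro ⟨l, v, S⟩ b hb
  cases l with
  | none => simp at hb
  | some l =>
    obtain rfl := Option.some.inj hb
    exact congrArg some (stepAux_liftStmt (M.m l) v S)

end Post

/-- Postprocessing preserves polynomial-time uniformity. -/
theorem PolyTimeUniform.postprocess {F G : List Bool → Circuit} (hF : PolyTimeUniform F)
    (mid post : List Sym) (h : Sym → List Sym) (hh : ∀ a, (h a).length ≤ 2)
    (hG : ∀ x, ∃ m w, (F x).encode = unary m ++ w ∧ w.head? ≠ some .one ∧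
      (G x).encode = postWord mid post h m w) : PolyTimeUniform G := by
  obtain ⟨⟨⟨M, ei, eo⟩, p, hrun⟩⟩ := hF
  refine ⟨⟨⟨postMachine eo mid post h, ei, eo⟩,
    -- With L = m + |w| the length of the original output, the postprocessing takes at most 4L +
    -- |mid| + |post| + 6 steps, and L is at most |x| + p(|x|) * `maxPush M`.
    p + 4 * (Polynomial.X + p * (maxPush M : Polynomial ℕ)) +
      ((mid.length + post.length + 6 : ℕ) : Polynomial ℕ), fun x => ?_⟩⟩
  have hx := hrun x
  have hr : ReachesIn M.step hx.steps (initList M (x.map ei.symm))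
      (haltList M ((F x).encode.map eo.symm)) := hx.evals_in_steps
  have ht : hx.steps ≤ p.eval x.length := hx.steps_le_m
  have hs := (hG x).choose_spec.choose_spec
  generalize (hG x).choose_spec.choose = w at hs
  generalize (hG x).choose = m at hs
  obtain ⟨h1, h2, h3⟩ := hs
  replace hr : ReachesIn M.step hx.steps (initList M (x.map ei.symm))
      (haltList M ((unary m ++ w).map eo.symm)) := ReachesIn.congr rfl (by rw [h1]) hr
  have hl := output_length_le M hr
  have hfin := postMachine_run eo mid post h h2 hr
  refine ⟨⟨hx.steps + (m + 1 + (m + 1) + (2 * w.length + 1) +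
    ((postWord mid post h m w).length + 1)), ?_⟩, ?_⟩
  · exact ReachesIn.congr rfl (congrArg (fun w => haltList (postMachine eo mid post h)
      (w.map eo.symm)) h3.symm) hfin
  · have hfl : (w.flatMap h).length ≤ 2 * w.length := by
      clear * - hh
      induction w with
      | nil => simp
      | cons a w ih =>
        have := hh a
        simp only [List.flatMap_cons, List.length_append, List.length_cons]
        omega
    have hmul : hx.steps * maxPush M ≤ p.eval x.length * maxPush M :=
      Nat.mul_le_mul_right _ ht
    simp only [List.length_map, List.length_append, unary, List.length_replicate] at hl
    simp only [postWord, List.length_append, unary, List.length_replicate, Polynomial.eval_add,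
      Polynomial.eval_mul, Polynomial.eval_X, Polynomial.eval_natCast, List.length_cons,
      List.length_nil, id, Nat.cast_id]
    have h4 : Polynomial.eval x.length (4 : Polynomial ℕ) = 4 := Polynomial.eval_ofNat 4 _
    rw [h4]
    omega

/-! ### The circuit with a weakly excited control qubit -/

/-- A gate on the last `n` qubits of a register of `n + 1` qubits, with the first qubit as an
additional control. -/
def Gate.controlled {n : ℕ} (g : Gate n) : Gate (n + 1) where
  kind := g.kind
  target := g.target.succ
  -- The new control stands last and has index 0, whose unary form is empty: it contributes a single
  -- `control` at the end of the gate's word.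
  controls := g.controls.map Fin.succ ++ [0]
  distinct := by
    have h := g.distinct
    rw [List.nodup_cons] at h
    simp only [List.nodup_cons, List.mem_append, List.mem_map, List.mem_singleton]
    refine ⟨?_, ?_⟩
    · rintro (⟨c, hc, hcg⟩ | h0)
      · exact h.1 (Fin.succ_injective _ hcg ▸ hc)
      · exact Fin.succ_ne_zero _ h0
    · refine List.Nodup.append (h.2.map (Fin.succ_injective _)) (List.nodup_singleton _) ?_
      simp [List.disjoint_singleton]

/-- A gate without controls. -/
def Gate.single {n : ℕ} (k : Kind) (i : Fin n) : Gate n := ⟨k, i, [], by simp⟩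

/-- A gate with one control `j`. -/
def Gate.ctrl {n : ℕ} (k : Kind) (i j : Fin n) (h : i ≠ j) : Gate n := ⟨k, i, [j], by simpa using h⟩

/-- The first qubit of a circuit. -/
def Circuit.fst (C : Circuit) : Fin C.n := ⟨0, C.pos⟩

/-- The gates that prepare the control qubit in a state close to `|0⟩`. -/
def Circuit.prelude (C : Circuit) (b : ℕ) : List (Gate (C.n + 1)) :=
  -- The phase gate acts trivially, its target being in |0⟩. It is there because its word ends in
  -- `control`, like that of every controlled gate, so the rewriting needs no exception for the
  -- first gate.
  [.single (.rot C.n b) 0, .ctrl .phase C.fst.succ 0 (Fin.succ_ne_zero _)]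

/-- The gates that write the conjunction of the control qubit and the first qubit of the
controlled circuit onto the control qubit. -/
def Circuit.finale (C : Circuit) : List (Gate (C.n + 1)) :=
  -- On the branch with control 1, the first CNOT negates the output qubit and the second clears the
  -- control where the output had been 0. The other branch is all zeros and stays fixed.
  [.ctrl .flip C.fst.succ 0 (Fin.succ_ne_zero _), .ctrl .flip 0 C.fst.succ (Fin.succ_ne_zero _).symm]

/-- The circuit in which all gates of `C` are controlled by a qubit that is in the state `|1⟩` with
probability `1 / (C.n + 1) ^ b`. -/
def Circuit.weaken (b : ℕ) (C : Circuit) : Circuit where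
  n := C.n + 1
  pos := Nat.succ_pos _
  gates := C.prelude b ++ C.gates.map Gate.controlled ++ C.finale

/-! ### Descriptions of weakened circuits -/

/-- The rewriting of symbols that describes `Gate.controlled`. -/
def controlledSym : Sym → List Sym
  | .one => [.one]
  -- A kind symbol starts a gate; the `control` written before it closes the preceding gate.
  | .had => [.control, .had]
  | .phase => [.control, .phase]
  | .flip => [.control, .flip]
  | .rot => [.control, .rot]
  | .exponent => [.exponent]
  -- Qubit indices shift by one, whereas rotation parameters, following `rot` and `exponent`, do
  -- not.
  | .target => [.target, .one]
  | .control => [.control, .one]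

theorem length_controlledSym_le (a : Sym) : (controlledSym a).length ≤ 2 := by
  cases a <;> simp [controlledSym]

theorem flatMap_controlledSym_unary (k : ℕ) : (unary k).flatMap controlledSym = unary k := by
  induction k with
  | zero => rfl
  | succ k ih => rw [unary, List.replicate_succ, List.flatMap_cons, ← unary, ih]; rfl

theorem flatMap_controlledSym_kind (k : Kind) :
    k.encode.flatMap controlledSym = .control :: k.encode := by
  cases k <;>
    simp [Kind.encode, controlledSym, flatMap_controlledSym_unary]

theorem Gate.encode_eq {n : ℕ} (g : Gate n) : g.encode =
    g.kind.encode ++ Sym.target :: unary g.target ++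
      g.controls.flatMap (fun c : Fin n => Sym.control :: unary c) := by
  rw [Gate.encode]
  congr 1
  induction g.controls with
  | nil => rfl
  | cons c l ih => exact congrArg (fun w => Sym.control :: unary c ++ w) ih

/-- A letter-by-letter rewriting cannot see where a gate ends, so the closing `control` is written
when the next gate begins. The two words agree up to this delay, which telescopes along a list of
gates. -/
theorem encode_controlled {n : ℕ} (g : Gate n) :
    .control :: g.controlled.encode = g.encode.flatMap controlledSym ++ [.control] := by
  have hc : ∀ l : List (Fin n),
      (l.flatMap fun c : Fin n => Sym.control :: unary c).flatMap controlledSym =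
      (l.map Fin.succ).flatMap fun c : Fin (n + 1) => Sym.control :: unary c := by
    intro l
    induction l with
    | nil => rfl
    | cons c l ih =>
      rw [List.map_cons, List.flatMap_cons, List.flatMap_append, List.flatMap_cons,
        List.flatMap_cons, ih, flatMap_controlledSym_unary]
      rfl
  simp only [Gate.encode_eq, Gate.controlled, List.flatMap_append, List.flatMap_cons,
    flatMap_controlledSym_kind, flatMap_controlledSym_unary, hc]
  simp [controlledSym, unary, List.replicate_succ]

theorem encode_map_controlled {n : ℕ} (l : List (Gate n)) :
    .control :: (l.map Gate.controlled).flatMap Gate.encode =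
      (l.flatMap Gate.encode).flatMap controlledSym ++ [.control] := by
  induction l with
  | nil => rfl
  | cons g l ih =>
    rw [List.map_cons, List.flatMap_cons, List.flatMap_cons, List.flatMap_append, ← List.cons_append,
      encode_controlled, List.append_assoc, List.append_assoc, ← ih]
    rfl

/-- The description of the control preparation, without the size and the last control. -/
def preludeWord (b : ℕ) : List Sym :=
  .exponent :: unary b ++ [.target, .phase, .target, .one]

def finaleWord : List Sym :=
  [.control, .flip, .target, .one, .control, .flip, .target, .control, .one]

theorem encode_weaken (b : ℕ) (C : Circuit) : (C.weaken b).encode =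
    postWord (preludeWord b) finaleWord controlledSym C.n (C.gates.flatMap Gate.encode) := by
  have h := encode_map_controlled C.gates
  -- The first `control` produced here, from the first gate or else from `finaleWord`, completes the
  -- phase gate of the prelude.
  have h2 : (C.gates.flatMap Gate.encode).flatMap controlledSym ++ finaleWord =
      Sym.control :: ((C.gates.map Gate.controlled).flatMap Gate.encode ++ finaleWord.tail) := by
    rw [← List.cons_append, h, List.append_assoc]; rfl
  rw [postWord, List.append_assoc, h2]
  simp [Circuit.encode, Circuit.weaken, Circuit.prelude, Circuit.finale, Gate.single, Gate.ctrl,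
    Gate.encode, Kind.encode, Circuit.fst, preludeWord, finaleWord, unary, List.replicate_succ',
    List.append_assoc]

/-- Every gate's word begins with its kind, so the leading unary number can be recognized by its
end. -/
theorem head_flatMap_encode {n : ℕ} (l : List (Gate n)) :
    (l.flatMap Gate.encode).head? ≠ some .one := by
  cases l with
  | nil => simp
  | cons g l =>
    rw [List.flatMap_cons, Gate.encode]
    cases g.kind <;> simp [Kind.encode]

theorem PolyTimeUniform.weaken {F : List Bool → Circuit} (hF : PolyTimeUniform F) (b : ℕ) :
    PolyTimeUniform (fun x => (F x).weaken b) :=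
  hF.postprocess (preludeWord b) finaleWord controlledSym length_controlledSym_le fun x =>
    ⟨(F x).n, (F x).gates.flatMap Gate.encode, rfl, head_flatMap_encode _, encode_weaken b (F x)⟩

theorem arity_weaken_le {C : Circuit} (hC : ∀ g ∈ C.gates, g.arity ≤ 2) (b : ℕ) :
    ∀ g ∈ (C.weaken b).gates, g.arity ≤ 3 := by
  suffices h : ∀ g : Gate (C.n + 1),
      g ∈ C.prelude b ++ C.gates.map Gate.controlled ++ C.finale → g.arity ≤ 3 from h
  intro g hg
  simp only [Circuit.prelude, Circuit.finale, List.mem_append, List.mem_map,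
    List.mem_cons, List.not_mem_nil, or_false] at hg
  rcases hg with ((rfl | rfl) | ⟨g, hg, rfl⟩) | (rfl | rfl)
  · simp [Gate.single, Gate.arity]
  · simp [Gate.ctrl, Gate.arity]
  · have := hC g hg
    simp only [Gate.arity, Gate.controlled, List.length_append, List.length_map,
      List.length_cons, List.length_nil] at this ⊢
    omega
  · simp [Gate.ctrl, Gate.arity]
  · simp [Gate.ctrl, Gate.arity]

theorem Gate.IsBasic.arity_le {n : ℕ} {g : Gate n} (h : g.IsBasic) : g.arity ≤ 2 := by
  rcases h with h | h | h <;> omega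

/-! ### Norms and amplitudes along a circuit -/

/-- The squared norm of a state. -/
def normSq {n : ℕ} (ψ : StateVec n) : ℝ := ∑ x, ‖ψ x‖ ^ 2

/-- Negation of one bit. -/
def toggle {n : ℕ} (i : Fin n) : Equiv.Perm (Fin n → Bool) :=
  Function.Involutive.toPerm (fun x => Function.update x i (!x i)) (fun x => by simp)

theorem rotEps_nonneg (a b : ℕ) : 0 ≤ rotEps a b := by unfold rotEps; positivity

theorem rotEps_le_one (a b : ℕ) : rotEps a b ≤ 1 := by
  unfold rotEps
  rw [div_le_one (by positivity)]
  exact one_le_pow₀ (by linarith [Nat.cast_nonneg (α := ℝ) a])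

theorem norm_sq_re_im (z : ℂ) : ‖z‖ ^ 2 = z.re ^ 2 + z.im ^ 2 := by
  rw [← Complex.normSq_eq_norm_sq, Complex.normSq_apply]; ring

/-- The matrices of all kinds of gates are unitary. -/
theorem Kind.matrix_isometry (k : Kind) (u v : ℂ) :
    ‖k.matrix true true * u + k.matrix true false * v‖ ^ 2 +
      ‖k.matrix false true * u + k.matrix false false * v‖ ^ 2 = ‖u‖ ^ 2 + ‖v‖ ^ 2 := by
  cases k with
  | had =>
    have h : √2 ^ 2 = (2 : ℝ) := Real.sq_sqrt (by norm_num)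
    simp only [Kind.matrix, Matrix.of_apply, norm_sq_re_im]
    simp
    linear_combination ((u.re ^ 2 + u.im ^ 2 + v.re ^ 2 + v.im ^ 2) / 2) * h
  | phase =>
    have h : ‖Complex.exp (Real.pi / 4 * Complex.I)‖ = 1 := by
      have := Complex.norm_exp_ofReal_mul_I (Real.pi / 4)
      push_cast at this
      exact this
    simp [Kind.matrix, h]
  | flip => simp [Kind.matrix]; ring
  | rot a b =>
    have h1 : √(1 - rotEps a b) ^ 2 = 1 - rotEps a b :=
      Real.sq_sqrt (by linarith [rotEps_le_one a b])
    have h2 : √(rotEps a b) ^ 2 = rotEps a b := Real.sq_sqrt (rotEps_nonneg a b)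
    simp only [Kind.matrix, Matrix.of_apply, norm_sq_re_im]
    simp
    linear_combination (u.re ^ 2 + u.im ^ 2 + v.re ^ 2 + v.im ^ 2) * (h1 + h2)

theorem Gate.apply_of_controls {n : ℕ} (g : Gate n) (ψ : StateVec n) {x : Fin n → Bool}
    (h : ∀ c ∈ g.controls, x c = true) : g.apply ψ x =
      g.kind.matrix (x g.target) true * ψ (Function.update x g.target true) +
      g.kind.matrix (x g.target) false * ψ (Function.update x g.target false) := by
  rw [Gate.apply, if_pos h, Fintype.sum_bool]

theorem Gate.apply_of_not_controls {n : ℕ} (g : Gate n) (ψ : StateVec n) {x : Fin n → Bool}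
    (h : ¬ ∀ c ∈ g.controls, x c = true) : g.apply ψ x = ψ x := if_neg h

theorem toggle_apply {n : ℕ} (i : Fin n) (x : Fin n → Bool) :
    toggle i x = Function.update x i (!x i) := rfl

theorem Gate.controls_toggle {n : ℕ} (g : Gate n) (x : Fin n → Bool) :
    (∀ c ∈ g.controls, toggle g.target x c = true) ↔ ∀ c ∈ g.controls, x c = true := by
  refine forall₂_congr fun c hc => ?_
  have hne : c ≠ g.target := fun e => (List.nodup_cons.1 g.distinct).1 (e ▸ hc)
  rw [toggle_apply, Function.update_of_ne hne]

/-- Pair each label with its toggle at the target. Both have the same control values, so on each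
pair the gate is the identity or a 2×2 unitary. Summing over all labels counts every pair twice. -/
theorem Gate.normSq_apply {n : ℕ} (g : Gate n) (ψ : StateVec n) :
    normSq (g.apply ψ) = normSq ψ := by
  have hdouble : ∀ φ : StateVec n,
      2 * normSq φ = ∑ x, (‖φ x‖ ^ 2 + ‖φ (toggle g.target x)‖ ^ 2) := by
    intro φ
    rw [Finset.sum_add_distrib, Equiv.sum_comp (toggle g.target) fun x => ‖φ x‖ ^ 2, normSq, two_mul]
  suffices 2 * normSq (g.apply ψ) = 2 * normSq ψ by linarith
  rw [hdouble, hdouble]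
  refine Finset.sum_congr rfl fun x _ => ?_
  by_cases h : ∀ c ∈ g.controls, x c = true
  · rw [g.apply_of_controls ψ h, g.apply_of_controls ψ ((g.controls_toggle x).2 h)]
    have hiso := g.kind.matrix_isometry (ψ (Function.update x g.target true))
      (ψ (Function.update x g.target false))
    rw [toggle_apply]
    cases hx : x g.target
    · have hxx : Function.update x g.target false = x := by rw [← hx, Function.update_eq_self]
      simp only [Function.update_self, Function.update_idem, Bool.not_false]
      rw [add_comm, hiso, hxx, add_comm]
    · have hxx : Function.update x g.target true = x := by rw [← hx, Function.update_eq_self]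
      simp only [Function.update_self, Function.update_idem, Bool.not_true]
      rw [hiso, hxx]
  · rw [g.apply_of_not_controls ψ h,
      g.apply_of_not_controls ψ (fun h' => h ((g.controls_toggle x).1 h'))]

theorem normSq_zeroState (n : ℕ) : normSq (zeroState n) = 1 := by
  rw [normSq, Finset.sum_eq_single (fun _ => false)]
  · simp [zeroState]
  · intro x _ hx; simp [zeroState, hx]
  · simp

theorem normSq_foldl {n : ℕ} (l : List (Gate n)) (ψ : StateVec n) :
    normSq (l.foldl (fun ψ g => g.apply ψ) ψ) = normSq ψ := by
  induction l generalizing ψ with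
  | nil => rfl
  | cons g l ih => rw [List.foldl_cons, ih, g.normSq_apply]

theorem Circuit.normSq_stateAfter (C : Circuit) (t : ℕ) : normSq (C.stateAfter t) = 1 := by
  rw [Circuit.stateAfter, normSq_foldl, normSq_zeroState]

theorem Circuit.probOne_nonneg (C : Circuit) : 0 ≤ C.probOne :=
  Finset.sum_nonneg fun x _ => by split_ifs <;> positivity

theorem Circuit.probOne_le_one (C : Circuit) : C.probOne ≤ 1 := by
  rw [← C.normSq_stateAfter C.gates.length]
  exact Finset.sum_le_sum fun x _ => by split_ifs <;> first | rfl | positivity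

/-- Controlled gates do not change the amplitude of `|0⟩ⁿ`. -/
theorem foldl_apply_zero {n : ℕ} (l : List (Gate n)) (hl : ∀ g ∈ l, g.controls ≠ [])
    (ψ : StateVec n) :
    l.foldl (fun ψ g => g.apply ψ) ψ (fun _ => false) = ψ (fun _ => false) := by
  induction l generalizing ψ with
  | nil => rfl
  | cons g l ih =>
    rw [List.foldl_cons, ih (fun g' hg' => hl g' (List.mem_cons_of_mem _ hg')),
      g.apply_of_not_controls]
    intro h
    obtain ⟨c, hc⟩ := List.exists_mem_of_ne_nil _ (hl g List.mem_cons_self)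
    simpa using h c hc

/-- The state of the register after the preparation of the control qubit. -/
theorem single_rot_zeroState (n a b : ℕ) (x : Fin (n + 1) → Bool) :
    (Gate.single (.rot a b) 0).apply (zeroState (n + 1)) x =
      if Fin.tail x = fun _ => false then
        if x 0 then ((√(rotEps a b) : ℝ) : ℂ) else ((√(1 - rotEps a b) : ℝ) : ℂ) else 0 := by
  rw [Gate.apply_of_controls _ _ (by simp [Gate.single])]
  have h : ∀ c : Bool, (Function.update x 0 c = fun _ => false) ↔
      c = false ∧ Fin.tail x = fun _ => false := by
    intro c
    constructor
    · intro h
      refine ⟨by simpa using congrFun h 0, ?_⟩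
      funext i
      simpa [Fin.tail] using congrFun h i.succ
    · rintro ⟨rfl, h⟩
      funext i
      refine Fin.cases (by simp) (fun i => ?_) i
      simpa [Fin.tail] using congrFun h i
  simp only [Gate.single, zeroState, h, Kind.matrix, Matrix.of_apply]
  cases x 0 <;> simp

/-- The rotation sets the amplitude of the all-zero label to √(1-ε); every later gate has a control
and leaves it alone. Before the rotation it is 1. -/
theorem le_norm_sq_weaken_zero (C : Circuit) (b t : ℕ) :
    1 - rotEps C.n b ≤ ‖(C.weaken b).stateAfter t (fun _ => false)‖ ^ 2 := by
  cases t with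
  | zero => simp [Circuit.stateAfter, zeroState, rotEps_nonneg]
  | succ t =>
    rw [Circuit.stateAfter]
    change _ ≤ ‖(List.foldl (fun ψ g => g.apply ψ) (zeroState (C.n + 1))
      (List.take (t + 1) (Gate.single (.rot C.n b) 0 ::
        (([Gate.ctrl .phase C.fst.succ 0 (Fin.succ_ne_zero _)] ++ C.gates.map Gate.controlled) ++
          C.finale))) : StateVec (C.n + 1)) (fun _ => false)‖ ^ 2
    rw [List.take_succ_cons, List.foldl_cons, foldl_apply_zero, single_rot_zeroState]
    · have : Fin.tail (fun _ => false : Fin (C.n + 1) → Bool) = fun _ => false := rfl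
      rw [if_pos this]
      simp [Real.sq_sqrt (sub_nonneg.2 (rotEps_le_one C.n b))]
    · intro g hg
      have hg := List.mem_of_mem_take hg
      simp only [Circuit.finale, List.mem_append, List.mem_map,
        List.mem_cons, List.not_mem_nil, or_false] at hg
      rcases hg with (rfl | ⟨g, hg, rfl⟩) | (rfl | rfl) <;> simp [Gate.ctrl, Gate.controlled]

/-! ### The outcome probability of the weakened circuit -/

/-- The state `c |0⟩|0…0⟩ + s |1⟩|φ⟩`. -/
def branchState {n : ℕ} (c s : ℂ) (φ : StateVec n) : StateVec (n + 1) := fun x =>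
  if x 0 then s * φ (Fin.tail x) else if Fin.tail x = fun _ => false then c else 0

theorem tail_update_succ {n : ℕ} (x : Fin (n + 1) → Bool) (i : Fin n) (b : Bool) :
    Fin.tail (Function.update x i.succ b) = Function.update (Fin.tail x) i b :=
  Fin.tail_update_succ x i b

theorem controlled_apply_branchState {n : ℕ} (g : Gate n) (c s : ℂ) (φ : StateVec n) :
    g.controlled.apply (branchState c s φ) = branchState c s (g.apply φ) := by
  funext x
  have hc : (∀ j ∈ g.controlled.controls, x j = true) ↔
      x 0 = true ∧ ∀ j ∈ g.controls, Fin.tail x j = true := by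
    simp [Gate.controlled, Fin.tail, or_imp, forall_and, and_comm]
  by_cases h0 : x 0 = true
  · by_cases h : ∀ j ∈ g.controls, Fin.tail x j = true
    · rw [Gate.apply_of_controls _ _ (hc.2 ⟨h0, h⟩)]
      have h1 : ∀ b, (Function.update x g.target.succ b) 0 = true := fun b => by
        rw [Function.update_of_ne (Fin.succ_ne_zero _).symm, h0]
      simp only [branchState, h0, if_true, Gate.apply_of_controls _ _ h]
      simp only [Gate.controlled, h1, if_true, tail_update_succ]
      simp only [Fin.tail]
      ring
    · rw [Gate.apply_of_not_controls _ _ (fun h' => h (hc.1 h').2)]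
      simp only [branchState, h0, if_true, Gate.apply_of_not_controls _ _ h]
  · rw [Gate.apply_of_not_controls _ _ (fun h' => h0 (hc.1 h').1)]
    simp only [branchState, if_neg h0]

theorem foldl_controlled {n : ℕ} (l : List (Gate n)) (c s : ℂ) (φ : StateVec n) :
    (l.map Gate.controlled).foldl (fun ψ g => g.apply ψ) (branchState c s φ) =
      branchState c s (l.foldl (fun ψ g => g.apply ψ) φ) := by
  induction l generalizing φ with
  | nil => rfl
  | cons g l ih => rw [List.map_cons, List.foldl_cons, List.foldl_cons,
      controlled_apply_branchState, ih]

theorem prelude_state (C : Circuit) (b : ℕ) :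
    (C.prelude b).foldl (fun ψ g => g.apply ψ) (zeroState (C.n + 1)) =
      branchState ((√(1 - rotEps C.n b) : ℝ) : ℂ) ((√(rotEps C.n b) : ℝ) : ℂ)
        (zeroState C.n) := by
  have h1 : (Gate.single (.rot C.n b) 0).apply (zeroState (C.n + 1)) =
      branchState ((√(1 - rotEps C.n b) : ℝ) : ℂ) ((√(rotEps C.n b) : ℝ) : ℂ)
        (zeroState C.n) := by
    funext x
    rw [single_rot_zeroState, branchState, zeroState]
    cases x 0 <;> simp
  simp only [Circuit.prelude, List.foldl_cons, List.foldl_nil, h1]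
  funext x
  by_cases h0 : x 0 = true
  · rw [Gate.apply_of_controls _ _ (by simpa [Gate.ctrl] using h0)]
    simp only [Gate.ctrl, branchState, tail_update_succ, Kind.matrix, Matrix.of_apply,
      Function.update_of_ne (Fin.succ_ne_zero C.fst).symm, h0, if_true, zeroState]
    have h2 : Function.update (Fin.tail x) C.fst true ≠ fun _ => false := fun h => by
      simpa using congrFun h C.fst
    rw [if_neg h2]
    cases hx : x C.fst.succ
    · have hxx : Function.update (Fin.tail x) C.fst false = Fin.tail x := by
        rw [← hx]; exact Function.update_eq_self C.fst (Fin.tail x)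
      simp [hxx]
    · have hxx : Fin.tail x ≠ fun _ => false := fun h => by
        have := congrFun h C.fst
        simp [Fin.tail, hx] at this
      simp [hxx]
  · rw [Gate.apply_of_not_controls _ _ (by simpa [Gate.ctrl] using h0)]

theorem ctrl_flip_apply {n : ℕ} (i j : Fin n) (h : i ≠ j) (ψ : StateVec n) (x : Fin n → Bool) :
    (Gate.ctrl .flip i j h).apply ψ x = if x j then ψ (toggle i x) else ψ x := by
  by_cases hx : x j = true
  · rw [Gate.apply_of_controls _ _ (by simpa [Gate.ctrl] using hx), if_pos hx, toggle_apply]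
    simp only [Gate.ctrl, Kind.matrix, Matrix.of_apply]
    cases x i <;> simp
  · rw [Gate.apply_of_not_controls _ _ (by simpa [Gate.ctrl] using hx), if_neg hx]

theorem sum_toggle {n : ℕ} (i : Fin n) (f : (Fin n → Bool) → ℝ) :
    ∑ x, (if x i = true then 0 else f (toggle i x)) = ∑ x, if x i = true then f x else 0 := by
  rw [← Equiv.sum_comp (toggle i)]
  refine Finset.sum_congr rfl fun x _ => ?_
  have : toggle i (toggle i x) = x := by simp [toggle_apply]
  rw [this, toggle_apply, Function.update_self]
  cases x i <;> simp

/-- At a final label (1, z), the amplitude is s φ(z with its first bit negated) if that bit is 0.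
Otherwise it comes from the label (0, z) with z nonzero, where the branch state vanishes. -/
theorem probOne_weaken (C : Circuit) (b : ℕ) :
    (C.weaken b).probOne = rotEps C.n b * C.probOne := by
  have hstate : (C.weaken b).stateAfter (C.weaken b).gates.length =
      C.finale.foldl (fun ψ g => g.apply ψ) (branchState ((√(1 - rotEps C.n b) : ℝ) : ℂ)
        ((√(rotEps C.n b) : ℝ) : ℂ) (C.stateAfter C.gates.length)) := by
    rw [Circuit.stateAfter, List.take_length, Circuit.stateAfter, List.take_length,
      ← foldl_controlled, ← prelude_state, ← List.foldl_append, ← List.foldl_append]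
    exact congrArg (List.foldl (fun ψ (g : Gate (C.n + 1)) => g.apply ψ) (zeroState (C.n + 1)))
      (List.append_assoc _ _ _)
  rw [Circuit.probOne, Circuit.probOne, hstate]
  set φ := C.stateAfter C.gates.length
  set c := ((√(1 - rotEps C.n b) : ℝ) : ℂ)
  have hs : ‖((√(rotEps C.n b) : ℝ) : ℂ)‖ ^ 2 = rotEps C.n b := by
    simp [Real.sq_sqrt (rotEps_nonneg C.n b)]
  set s := ((√(rotEps C.n b) : ℝ) : ℂ)
  have hx : ∀ (y : Bool) (z : Fin C.n → Bool),
      (if (Fin.cons y z : Fin (C.n + 1) → Bool) 0 = true then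
        ‖C.finale.foldl (fun ψ g => g.apply ψ) (branchState c s φ) (Fin.cons y z)‖ ^ 2 else 0) =
      if y then (if z C.fst = true then 0 else rotEps C.n b * ‖φ (toggle C.fst z)‖ ^ 2) else 0 := by
    intro y z
    simp only [Circuit.finale, List.foldl_cons, List.foldl_nil, ctrl_flip_apply, Fin.cons_zero,
      Fin.cons_succ]
    cases y
    · simp
    · cases hz : z C.fst
      · have : toggle C.fst.succ (Fin.cons true z : Fin (C.n + 1) → Bool) =
            Fin.cons true (toggle C.fst z) := by
          rw [toggle_apply, toggle_apply, Fin.cons_succ, Fin.cons_update]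
        simp [this, branchState, mul_pow, hs]
      · have h1 : toggle 0 (Fin.cons true z : Fin (C.n + 1) → Bool) = Fin.cons false z := by
          rw [toggle_apply, Fin.cons_zero, Fin.update_cons_zero]; rfl
        have h2 : z ≠ fun _ => false := fun h => by simp [h] at hz
        simp [h1, branchState, h2]
  calc _ = ∑ p : Bool × (Fin C.n → Bool), if p.1 then
          (if p.2 C.fst = true then 0 else rotEps C.n b * ‖φ (toggle C.fst p.2)‖ ^ 2) else 0 := by
        refine (Fintype.sum_equiv (Fin.consEquiv fun _ => Bool) _ _ fun p => ?_).symm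
        exact (hx p.1 p.2).symm
    _ = ∑ z : Fin C.n → Bool,
          (if z C.fst = true then 0 else rotEps C.n b * ‖φ (toggle C.fst z)‖ ^ 2) := by
        rw [Fintype.sum_prod_type, Fintype.sum_bool]; simp
    _ = _ := by
        rw [sum_toggle C.fst fun z => rotEps C.n b * ‖φ z‖ ^ 2, Finset.mul_sum]
        exact Finset.sum_congr rfl fun z _ => by rw [mul_ite, mul_zero]; rfl

open scoped ComplexOrder Matrix

/-! ### Entropy of a state close to a product state -/

/-- Glueing labels, as a bijection. -/
def glueEquiv {n : ℕ} (A : Finset (Fin n)) :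
    (({i // i ∈ A} → Bool) × ({i // i ∉ A} → Bool)) ≃ (Fin n → Bool) where
  toFun p := glue A p.1 p.2
  invFun x := (fun i => x i, fun i => x i)
  left_inv p := by
    ext i
    · simp [glue, i.2]
    · simp [glue, i.2]
  right_inv x := by
    funext i
    by_cases h : i ∈ A <;> simp [glue]

theorem trace_reduced {n : ℕ} (ψ : StateVec n) (A : Finset (Fin n)) :
    (reduced ψ A).trace = (normSq ψ : ℂ) := by
  rw [normSq, ← Equiv.sum_comp (glueEquiv A) fun x => ‖ψ x‖ ^ 2, Fintype.sum_prod_type]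
  simp only [Matrix.trace, Matrix.diag, reduced, Matrix.of_apply, Complex.ofReal_sum, glueEquiv,
    Equiv.coe_fn_mk]
  refine Finset.sum_congr rfl fun x _ => Finset.sum_congr rfl fun z _ => ?_
  rw [← starRingEnd_apply, Complex.mul_conj, Complex.normSq_eq_norm_sq]

theorem reduced_eq_mul {n : ℕ} (ψ : StateVec n) (A : Finset (Fin n)) :
    reduced ψ A = (Matrix.of fun x z => ψ (glue A x z)) * (Matrix.of fun x z => ψ (glue A x z))ᴴ := by
  ext x y
  simp [reduced, Matrix.mul_apply]

theorem posSemidef_reduced {n : ℕ} (ψ : StateVec n) (A : Finset (Fin n)) :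
    (reduced ψ A).PosSemidef := by
  rw [reduced_eq_mul]
  exact Matrix.posSemidef_self_mul_conjTranspose _

theorem le_reduced_diag {n : ℕ} (ψ : StateVec n) (A : Finset (Fin n)) :
    ‖ψ (fun _ => false)‖ ^ 2 ≤ (reduced ψ A (fun _ => false) (fun _ => false)).re := by
  have h : ∀ z, (ψ (glue A (fun _ => false) z) * star (ψ (glue A (fun _ => false) z))).re =
      ‖ψ (glue A (fun _ => false) z)‖ ^ 2 := by
    intro z
    rw [← starRingEnd_apply, Complex.mul_conj, Complex.normSq_eq_norm_sq, Complex.ofReal_re]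
  have h0 : glue A (fun _ => false) (fun _ => false) = fun _ => false := by
    funext i; simp [glue]
  simp only [reduced, Matrix.of_apply, Complex.re_sum, h]
  have := Finset.single_le_sum (f := fun z => ‖ψ (glue A (fun _ => false) z)‖ ^ 2)
    (fun _ _ => by positivity) (Finset.mem_univ (fun _ => false))
  simpa only [h0] using this

/-- A diagonal entry is at most the largest eigenvalue. -/
theorem exists_diag_le_eigenvalue {ι : Type*} [Fintype ι] [DecidableEq ι] {ρ : Matrix ι ι ℂ}
    (hρ : ρ.IsHermitian) (k : ι) : ∃ i, (ρ k k).re ≤ hρ.eigenvalues i := by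
  by_contra! hlt
  set U : Matrix ι ι ℂ := hρ.eigenvectorUnitary.1
  have hU : U * star U = 1 := Unitary.mul_star_self_of_mem hρ.eigenvectorUnitary.2
  have hone : ∑ i, ‖U k i‖ ^ 2 = 1 := by
    have h := congrFun (congrFun hU k) k
    rw [Matrix.mul_apply] at h
    have h2 : ∀ i, U k i * (star U) i k = ((‖U k i‖ ^ 2 : ℝ) : ℂ) := fun i => by
      rw [Matrix.star_apply, ← starRingEnd_apply, Complex.mul_conj, Complex.normSq_eq_norm_sq]
    simp only [h2, Matrix.one_apply_eq] at h
    exact_mod_cast h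
  -- The diagonal entry is an average of the eigenvalues with weights ‖U k i‖², so not all of them
  -- lie below it.
  have hkk : (ρ k k).re = ∑ i, hρ.eigenvalues i * ‖U k i‖ ^ 2 := by
    have h := congrFun (congrFun hρ.spectral_theorem k) k
    rw [Unitary.conjStarAlgAut_apply, Matrix.mul_apply] at h
    have h2 : ∀ i,
        (U * Matrix.diagonal (RCLike.ofReal ∘ hρ.eigenvalues) : Matrix ι ι ℂ) k i * (star U) i k =
        ((hρ.eigenvalues i * ‖U k i‖ ^ 2 : ℝ) : ℂ) := fun i => by
      rw [Matrix.mul_diagonal, Matrix.star_apply, ← starRingEnd_apply, mul_right_comm,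
        Complex.mul_conj, Complex.normSq_eq_norm_sq, mul_comm]
      push_cast
      rfl
    have h3 : ρ k k = ((∑ i, hρ.eigenvalues i * ‖U k i‖ ^ 2 : ℝ) : ℂ) := by
      rw [h, Complex.ofReal_sum]
      exact Finset.sum_congr rfl fun i _ => h2 i
    rw [h3, Complex.ofReal_re]
  have hlt2 : ∑ i, hρ.eigenvalues i * ‖U k i‖ ^ 2 < ∑ i, (ρ k k).re * ‖U k i‖ ^ 2 := by
    refine Finset.sum_lt_sum (fun i _ => by gcongr; exact (hlt i).le) ?_
    obtain ⟨i, _, hi⟩ := Finset.exists_ne_zero_of_sum_ne_zero (hone.trans_ne one_ne_zero)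
    exact ⟨i, Finset.mem_univ i, mul_lt_mul_of_pos_right (hlt i)
      (lt_of_le_of_ne (by positivity) hi.symm)⟩
  rw [← Finset.mul_sum, hone, ← hkk, mul_one] at hlt2
  exact lt_irrefl _ hlt2

/-- The logarithmic entropy of a distribution on `d` points that is concentrated, up to `ε`, on one
point. -/
theorem neg_sum_mul_log_le {ι : Type*} [Fintype ι] (p : ι → ℝ) (hp : ∀ i, 0 ≤ p i)
    (hsum : ∑ i, p i = 1) {ε : ℝ} (hε : 0 < ε) (i₀ : ι) (h₀ : 1 - ε ≤ p i₀)
    {D : ℝ} (hD : (Fintype.card ι : ℝ) ≤ D) (hD1 : 1 ≤ D) (hε1 : ε ≤ 1) :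
    -∑ i, p i * Real.log (p i) ≤ ε * (2 + Real.log D + Real.log (1 / ε)) := by
  classical
  -- Gibbs' inequality against unnormalized reference weights: 1 at `i₀` and ε/D elsewhere. The
  -- excess mass costs at most ε, and 1 - p i₀ at most another ε, whence the 2 in the bound.
  have gibbs : ∀ x q : ℝ, 0 ≤ x → 0 < q → -(x * Real.log x) ≤ -(x * Real.log q) + (q - x) := by
    intro x q hx hq
    rcases hx.eq_or_lt with rfl | hx
    · simpa using hq.le
    · have h := Real.log_le_sub_one_of_pos (div_pos hq hx)
      rw [Real.log_div hq.ne' hx.ne'] at h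
      have h2 := mul_le_mul_of_nonneg_left h hx.le
      have h3 : x * (q / x - 1) = q - x := by field_simp
      rw [h3] at h2
      linarith
  have hDpos : 0 < D := by linarith
  have hq : 0 < ε / D := div_pos hε hDpos
  have hlogq : -Real.log (ε / D) = Real.log D + Real.log (1 / ε) := by
    rw [Real.log_div hε.ne' hDpos.ne', one_div, Real.log_inv]; ring
  have hlognn : 0 ≤ Real.log D + Real.log (1 / ε) := by
    have h1 := Real.log_nonneg hD1
    have h2 := Real.log_nonneg (one_le_one_div hε hε1)
    linarith
  have hrest : ∑ i ∈ Finset.univ.erase i₀, p i = 1 - p i₀ := by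
    rw [← hsum, ← Finset.add_sum_erase _ _ (Finset.mem_univ i₀)]; ring
  have h1 := gibbs (p i₀) 1 (hp i₀) one_pos
  have h2 : ∑ i ∈ Finset.univ.erase i₀, -(p i * Real.log (p i)) ≤
      (1 - p i₀) * (Real.log D + Real.log (1 / ε)) + ε := by
    calc _ ≤ ∑ i ∈ Finset.univ.erase i₀, (p i * (Real.log D + Real.log (1 / ε)) + ε / D) := by
          refine Finset.sum_le_sum fun i _ => ?_
          have := gibbs (p i) _ (hp i) hq
          rw [← hlogq]
          linarith [hp i]
      _ = (1 - p i₀) * (Real.log D + Real.log (1 / ε)) +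
          ((Finset.univ.erase i₀).card : ℝ) * (ε / D) := by
          rw [Finset.sum_add_distrib, ← Finset.sum_mul, hrest, Finset.sum_const, nsmul_eq_mul]
      _ ≤ _ := by
          gcongr
          have hc : ((Finset.univ.erase i₀).card : ℝ) ≤ D := le_trans
            (by exact_mod_cast Finset.card_erase_le) hD
          calc _ ≤ D * (ε / D) := by gcongr
            _ = ε := by field_simp
  rw [← Finset.sum_neg_distrib, ← Finset.add_sum_erase _ _ (Finset.mem_univ i₀)]
  rw [Real.log_one, mul_zero] at h1
  have h3 : (1 - p i₀) * (Real.log D + Real.log (1 / ε)) ≤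
      ε * (Real.log D + Real.log (1 / ε)) := by
    gcongr; linarith
  linarith

/-- The entanglement entropies of a state that is close to `|0⟩ⁿ`. -/
theorem entanglementEntropy_le {n : ℕ} (ψ : StateVec n) (A : Finset (Fin n)) (hψ : normSq ψ = 1)
    {ε : ℝ} (hε : 0 < ε) (hε1 : ε ≤ 1) (h0 : 1 - ε ≤ ‖ψ (fun _ => false)‖ ^ 2) :
    entanglementEntropy ψ A ≤ 2 * ε * (2 + n + Real.log (1 / ε)) := by
  have hρ := reduced_isHermitian ψ A
  obtain ⟨i₀, hi₀⟩ := exists_diag_le_eigenvalue hρ (fun _ => false)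
  have hsum : ∑ i, hρ.eigenvalues i = 1 := by
    have h := hρ.trace_eq_sum_eigenvalues
    rw [trace_reduced, hψ] at h
    apply Complex.ofReal_injective
    rw [Complex.ofReal_sum]
    exact h.symm
  have hcard : (Fintype.card ({i // i ∈ A} → Bool) : ℝ) ≤ 2 ^ n := by
    rw [Fintype.card_fun, Fintype.card_bool, Fintype.card_coe]
    push_cast
    refine pow_le_pow_right₀ (by norm_num) ?_
    simpa using Finset.card_le_univ A
  have h := neg_sum_mul_log_le hρ.eigenvalues (posSemidef_reduced ψ A).eigenvalues_nonneg hsum hε i₀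
    (h0.trans ((le_reduced_diag ψ A).trans hi₀)) hcard (one_le_pow₀ (by norm_num)) hε1
  -- The passage to base 2 divides by log 2 > 1/2, which accounts for the factor 2.
  have hlog2 : (1 / 2 : ℝ) < Real.log 2 := by linarith [Real.log_two_gt_d9]
  have hlog2' : Real.log 2 ≤ 1 := by linarith [Real.log_two_lt_d9]
  have hlogD : Real.log (2 ^ n) ≤ n := by
    rw [Real.log_pow]
    exact mul_le_of_le_one_right (Nat.cast_nonneg n) hlog2'
  have hle : 0 ≤ Real.log (1 / ε) := Real.log_nonneg (one_le_one_div hε hε1)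
  have hE : entanglementEntropy ψ A =
      (-∑ i, hρ.eigenvalues i * Real.log (hρ.eigenvalues i)) / Real.log 2 := by
    rw [entanglementEntropy, vonNeumannEntropy, neg_div, Finset.sum_div]
    congr 1
    exact Finset.sum_congr rfl fun i _ => by rw [Real.logb, mul_div_assoc]
  rw [hE, div_le_iff₀ (by linarith)]
  have hB : 0 ≤ ε * (2 + n + Real.log (1 / ε)) := by positivity
  calc _ ≤ ε * (2 + n + Real.log (1 / ε)) := h.trans (by gcongr)
    _ = 2 * (ε * (2 + n + Real.log (1 / ε))) * (1 / 2) := by ring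
    _ ≤ 2 * (ε * (2 + n + Real.log (1 / ε))) * Real.log 2 := by gcongr
    _ = _ := by ring

/-- A polynomially small family dominates, up to a constant, the entropies of weakened circuits. -/
theorem PolynomiallySmall.exists_bound {δ : ℕ → ℝ} (hδ : PolynomiallySmall δ) :
    ∃ b : ℕ, ∃ C : ℝ, 0 < C ∧ ∀ n : ℕ, 1 ≤ n →
      2 * (1 / (n : ℝ) ^ b) * (2 + n + Real.log (1 / (1 / (n : ℝ) ^ b))) ≤ C * δ n := by
  obtain ⟨hpos, p, hp⟩ := hδ
  have hO : (fun n : ℕ => 1 / δ n) =O[Filter.atTop] fun n : ℕ => (n : ℝ) ^ p.natDegree := by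
    refine hp.trans ?_
    have h := Polynomial.isBigO_atTop_of_degree_le p (Polynomial.X ^ p.natDegree)
      (by rw [Polynomial.degree_X_pow]; exact Polynomial.degree_le_natDegree)
    simp only [Polynomial.eval_pow, Polynomial.eval_X] at h
    exact h.comp_tendsto tendsto_natCast_atTop_atTop
  set k := p.natDegree
  obtain ⟨c, hc⟩ := hO.bound
  obtain ⟨N, hN⟩ := Filter.eventually_atTop.1 hc
  obtain ⟨c', hc'0, hc'⟩ : ∃ c' : ℝ, 0 < c' ∧ ∀ n : ℕ, 1 ≤ n → 1 / δ n ≤ c' * (n : ℝ) ^ k := by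
    -- The sum absorbs the finitely many n below the threshold of the asymptotic bound.
    refine ⟨|c| + 1 + ∑ n ∈ Finset.range N, |1 / δ n|, by positivity, fun n hn => ?_⟩
    have hn1 : (1 : ℝ) ≤ (n : ℝ) ^ k := one_le_pow₀ (by exact_mod_cast hn)
    have hs : 0 ≤ ∑ n ∈ Finset.range N, |1 / δ n| := Finset.sum_nonneg fun _ _ => abs_nonneg _
    by_cases h : N ≤ n
    · have h1 := hN n h
      rw [Real.norm_eq_abs, Real.norm_eq_abs, abs_of_nonneg (by positivity : (0 : ℝ) ≤ (n : ℝ) ^ k)]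
        at h1
      refine (le_abs_self _).trans (h1.trans ?_)
      gcongr
      linarith [le_abs_self c]
    · have h1 : |1 / δ n| ≤ ∑ n ∈ Finset.range N, |1 / δ n| :=
        Finset.single_le_sum (f := fun n => |1 / δ n|) (fun _ _ => abs_nonneg _)
          (Finset.mem_range.2 (not_le.1 h))
      calc 1 / δ n ≤ |c| + 1 + ∑ n ∈ Finset.range N, |1 / δ n| := by
            linarith [le_abs_self (1 / δ n), abs_nonneg c]
        _ ≤ _ := le_mul_of_one_le_right (by positivity) hn1
  -- The bracket is at most (k + 4)n; the extra power of n cancels its n, and n^(-k) is at most c'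
  -- δ_n.
  refine ⟨k + 1, 2 * (k + 4) * c', by positivity, fun n hn => ?_⟩
  have hn0 : (0 : ℝ) < n := by exact_mod_cast hn
  have hn1 : (1 : ℝ) ≤ n := by exact_mod_cast hn
  have hlog : Real.log (1 / (1 / (n : ℝ) ^ (k + 1))) ≤ (k + 1) * n := by
    rw [one_div_one_div, Real.log_pow]
    push_cast
    gcongr
    exact (Real.log_le_sub_one_of_pos hn0).trans (by linarith)
  have hδn := hpos n hn
  have h1 : 1 ≤ c' * (n : ℝ) ^ k * δ n := by
    have := hc' n hn
    rwa [div_le_iff₀ hδn] at this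
  calc _ ≤ 2 * (1 / (n : ℝ) ^ (k + 1)) * (2 * n + n + (k + 1) * n) := by gcongr; linarith
    _ = 2 * (k + 4) * (1 / (n : ℝ) ^ k) := by field_simp; ring
    _ ≤ 2 * (k + 4) * (1 / (n : ℝ) ^ k * (c' * (n : ℝ) ^ k * δ n)) := by
        gcongr
        exact le_mul_of_one_le_right (by positivity) h1
    _ = _ := by field_simp

/-! ### Amplification -/

/-- Chebyshev's inequality for the binomial distribution. -/
theorem binomial_chebyshev (T : ℕ) (q : ℝ) (hq0 : 0 ≤ q) (hq1 : q ≤ 1) (S : Finset ℕ)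
    (hS : S ⊆ Finset.range (T + 1)) {r : ℝ} (hr : 0 < r) (hdev : ∀ k ∈ S, r ≤ |T * q - k|) :
    ∑ k ∈ S, (T.choose k : ℝ) * q ^ k * (1 - q) ^ (T - k) ≤ T * q / r ^ 2 := by
  have hv := congrArg (Polynomial.eval q) (bernsteinPolynomial.variance ℝ T)
  simp only [Polynomial.eval_finsetSum, bernsteinPolynomial, Polynomial.eval_mul,
    Polynomial.eval_pow, Polynomial.eval_sub, Polynomial.eval_X, Polynomial.eval_natCast,
    Polynomial.eval_one, nsmul_eq_mul] at hv
  have hw : ∀ k, 0 ≤ (T.choose k : ℝ) * q ^ k * (1 - q) ^ (T - k) := fun k => by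
    have := sub_nonneg.2 hq1
    positivity
  rw [le_div_iff₀ (by positivity)]
  calc _ = ∑ k ∈ S, r ^ 2 * ((T.choose k : ℝ) * q ^ k * (1 - q) ^ (T - k)) := by
        rw [← Finset.mul_sum, mul_comm]
    _ ≤ ∑ k ∈ S, (T * q - k) ^ 2 * ((T.choose k : ℝ) * q ^ k * (1 - q) ^ (T - k)) := by
        refine Finset.sum_le_sum fun k hk => mul_le_mul_of_nonneg_right ?_ (hw k)
        rw [← sq_abs (T * q - k)]
        gcongr
        exact hdev k hk
    _ ≤ ∑ k ∈ Finset.range (T + 1),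
          (T * q - k) ^ 2 * ((T.choose k : ℝ) * q ^ k * (1 - q) ^ (T - k)) :=
        Finset.sum_le_sum_of_subset_of_nonneg hS fun k _ _ => mul_nonneg (sq_nonneg _) (hw k)
    _ = T * q * (1 - q) := hv
    -- The variance is bounded by the mean Tq rather than by T/4: here q may be of order 1/T.
    _ ≤ _ := mul_le_of_le_one_right (by positivity) (by linarith)

theorem probAtLeast_le (C : Circuit) (T θ : ℕ) (h : (T : ℝ) * C.probOne < θ) :
    C.probAtLeast T θ ≤ T * C.probOne / (θ - T * C.probOne) ^ 2 := by
  refine binomial_chebyshev T _ C.probOne_nonneg C.probOne_le_one _ ?_ (sub_pos.2 h) ?_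
  · intro k hk
    have := Finset.mem_Icc.1 hk
    exact Finset.mem_range.2 (by omega)
  · intro k hk
    have : (θ : ℝ) ≤ k := by exact_mod_cast (Finset.mem_Icc.1 hk).1
    rw [abs_sub_comm]
    exact le_trans (by linarith) (le_abs_self _)

theorem le_probAtLeast (C : Circuit) (T θ : ℕ) (h : (θ : ℝ) < T * C.probOne) :
    1 - T * C.probOne / (T * C.probOne - θ) ^ 2 ≤ C.probAtLeast T θ := by
  have htot : ∑ k ∈ Finset.range (T + 1),
      (T.choose k : ℝ) * C.probOne ^ k * (1 - C.probOne) ^ (T - k) = 1 := by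
    have := add_pow C.probOne (1 - C.probOne) T
    rw [add_sub_cancel, one_pow] at this
    exact (Finset.sum_congr rfl fun k _ => by ring).trans this.symm
  have hlow := binomial_chebyshev T _ C.probOne_nonneg C.probOne_le_one
    (Finset.range (T + 1) \ Finset.Icc θ T) Finset.sdiff_subset (sub_pos.2 h) (by
      intro k hk
      rw [Finset.mem_sdiff, Finset.mem_range, Finset.mem_Icc] at hk
      have : (k : ℝ) ≤ θ := by exact_mod_cast (by omega : k ≤ θ)
      exact le_trans (by linarith) (le_abs_self _))
  have hsplit := Finset.sum_sdiff (f := fun k => (T.choose k : ℝ) * C.probOne ^ k *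
    (1 - C.probOne) ^ (T - k)) (s₁ := Finset.Icc θ T) (s₂ := Finset.range (T + 1)) (by
      intro k hk
      have := Finset.mem_Icc.1 hk
      exact Finset.mem_range.2 (by omega))
  rw [Circuit.probAtLeast]
  linarith

/-- The number of runs is 144/ε, so the mean number of ones does not depend on ε and a constant
threshold suffices. -/
theorem runs_mul_probOne (b : ℕ) (C : Circuit) :
    ((144 * (C.weaken b).n ^ b : ℕ) : ℝ) * (C.weaken b).probOne = 144 * C.probOne := by
  have hn : (C.weaken b).n = C.n + 1 := rfl
  rw [probOne_weaken, rotEps, hn]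
  push_cast
  field_simp

theorem weaken_accepts {C : Circuit} (b : ℕ) (h : 2 / 3 ≤ C.probOne) :
    2 / 3 ≤ (C.weaken b).probAtLeast (144 * (C.weaken b).n ^ b) 72 := by
  have hm := runs_mul_probOne b C
  have h1 := le_probAtLeast (C.weaken b) (144 * (C.weaken b).n ^ b) 72
    (by rw [hm]; push_cast; linarith)
  rw [hm] at h1
  refine le_trans ?_ h1
  -- The mean μ lies in [96, 144], where μ/(μ - 72)² is at most 96/24² = 1/6.
  have : 144 * C.probOne / (144 * C.probOne - (72 : ℕ)) ^ 2 ≤ 1 / 3 := by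
    push_cast
    rw [div_le_div_iff₀ (by nlinarith) (by norm_num)]
    nlinarith [C.probOne_le_one]
  linarith

theorem weaken_rejects {C : Circuit} (b : ℕ) (h : C.probOne ≤ 1 / 3) :
    (C.weaken b).probAtLeast (144 * (C.weaken b).n ^ b) 72 ≤ 1 / 3 := by
  have hm := runs_mul_probOne b C
  have h1 := probAtLeast_le (C.weaken b) (144 * (C.weaken b).n ^ b) 72
    (by rw [hm]; push_cast; linarith)
  rw [hm] at h1
  refine h1.trans ?_
  push_cast
  -- The mean μ is at most 48, so μ/(72 - μ)² is at most 48/24² = 1/12.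
  rw [div_le_div_iff₀ (by nlinarith) (by norm_num)]
  nlinarith [C.probOne_nonneg]

theorem entropyAtMost_weaken (b : ℕ) (C : Circuit) {β : ℝ}
    (hβ : 2 * (1 / ((C.weaken b).n : ℝ) ^ b) * (2 + (C.weaken b).n +
      Real.log (1 / (1 / ((C.weaken b).n : ℝ) ^ b))) ≤ β) : (C.weaken b).EntropyAtMost β := by
  intro t _ A
  have hε : rotEps C.n b = 1 / ((C.weaken b).n : ℝ) ^ b := by
    have hn : (C.weaken b).n = C.n + 1 := rfl
    rw [rotEps, hn]; push_cast; rfl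
  refine le_trans ?_ hβ
  rw [← hε]
  exact entanglementEntropy_le _ A ((C.weaken b).normSq_stateAfter t)
    (by unfold rotEps; positivity) (rotEps_le_one _ _) (le_norm_sq_weaken_zero C b t)

end LowEntQC

end

theorem mainTheorem2 (δ : ℕ → ℝ) (hδ : LowEntQC.PolynomiallySmall δ) :
    ∃ C : ℝ, 0 < C ∧ ∀ P : LowEntQC.PromiseProblem, LowEntQC.InBQP P →
      LowEntQC.SolvableWithEntropyAtMost (fun n => C * δ n) P := by
  obtain ⟨b, C, hC, hbound⟩ := hδ.exists_bound
  refine ⟨C, hC, ?_⟩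
  rintro P ⟨F, hF, hbasic, hyes, hno⟩
  refine ⟨fun x => (F x).weaken b, hF.weaken b,
    fun x => LowEntQC.arity_weaken_le (fun g hg => (hbasic x g hg).arity_le) b,
    fun x => LowEntQC.entropyAtMost_weaken b (F x) (hbound _ ((F x).weaken b).pos),
    144 * Polynomial.X ^ b, 72, fun x hx => ?_, fun x hx => ?_⟩
  · simpa using LowEntQC.weaken_accepts b (hyes x hx)
  · simpa using LowEntQC.weaken_rejects b (hno x hx)
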